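/- Theorem 1.2. For an integral domain $D$, let $D^+$ denote its absolute integral closure, that is, the integral closure of $D$ in an algebraic closure of the fraction field of $D$. Let $R$ be a principal ideal domain, and for a maximal ideal $\mathfrak m$ of $R$ let $\widehat R_{\mathfrak m} = \varprojlim_n R/\mathfrak m^n$ be the $\mathfrak m$-adic completion of $R$, which is an integral domain. Then $(\widehat R_{\mathfrak m})^+$ is a local ring for every maximal ideal $\mathfrak m$ of $R$, and a commutative ring $S$ is an integral domain isomorphic to a quotient ring $R[[X]]/I$ for some ideal $I$ of $R[[X]]$ if and only if $S$ is isomorphic, as a ring, to one of the following rings: 1. $R[[X]]$; 2. $R$; 3. $(R/\mathfrak m)[[X]]$ for some maximal ideal $\mathfrak m$ of $R$; 4. $R/\mathfrak m$ for some maximal ideal $\mathfrak m$ of $R$; 5. $\widehat R_{\mathfrak m}[\alpha]$ for some maximal ideal $\mathfrak m$ of $R$ and some element $\alpha$ of the unique maximal ideal of $(\widehat R_{\mathfrak m})^+$, where $\widehat R_{\mathfrak m}[\alpha]$ is the $\widehat R_{\mathfrak m}$-subalgebra of $(\widehat R_{\mathfrak m})^+$ generated by $\alpha$. -/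

import Mathlib

open scoped PowerSeries

/-- The `m`-adic completion of a principal ideal domain at a prime ideal is an integral domain. -/
instance adicCompletion_isDomain {R : Type*} [CommRing R] [IsDomain R]
    [IsPrincipalIdealRing R] (m : Ideal R) [hm : m.IsPrime] : IsDomain (AdicCompletion m R) := by
  obtain ⟨p, hp⟩ : ∃ p, m = Ideal.span {p} := ⟨_, (Ideal.span_singleton_generator m).symm⟩
  have hdvd : ∀ (k : ℕ) (r : R), (Ideal.Quotient.mk (m ^ k) r = 0 ↔ p ^ k ∣ r) := fun k r => by
    rw [Ideal.Quotient.eq_zero_iff_mem, hp, Ideal.span_singleton_pow, Ideal.mem_span_singleton]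
  have key : ∀ (i j : ℕ) (a b : R), p ^ (i + j) ∣ a * b → p ^ i ∣ a ∨ p ^ j ∣ b := by
    intro i j a b h
    rcases eq_or_ne p 0 with h0 | h0
    · subst h0
      rcases Nat.eq_zero_or_pos i with rfl | hi
      · simp
      rcases Nat.eq_zero_or_pos j with rfl | hj
      · simp
      rw [zero_pow (by omega), zero_dvd_iff] at h
      rw [zero_pow (by omega), zero_pow (by omega), zero_dvd_iff, zero_dvd_iff]
      exact mul_eq_zero.mp h
    · have hpp : Prime p := (Ideal.span_singleton_prime h0).mp (hp ▸ hm)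
      rcases Nat.eq_zero_or_pos i with rfl | hi
      · simp
      rcases Nat.eq_zero_or_pos j with rfl | hj
      · simp
      by_contra hcon
      rw [not_or] at hcon
      have ha : emultiplicity p a < i := emultiplicity_lt_iff_not_dvd.mpr hcon.1
      have hb : emultiplicity p b < j := emultiplicity_lt_iff_not_dvd.mpr hcon.2
      have hab := le_emultiplicity_of_pow_dvd h
      rw [emultiplicity_mul hpp] at hab
      have := ENat.add_lt_add ha hb
      push_cast at hab
      exact absurd hab (not_le.mpr this)
  have hlow : ∀ (i n : ℕ), i ≤ n → ∀ (a : R) (x : AdicCompletion m R),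
      Ideal.Quotient.mk (m ^ n) a = AdicCompletion.evalₐ m n x → p ^ i ∣ a →
        AdicCompletion.evalₐ m i x = 0 := by
    intro i n hin a x
    obtain ⟨f, rfl⟩ := AdicCompletion.mk_surjective m R x
    intro ha h
    rw [AdicCompletion.evalₐ_mk] at ha ⊢
    rw [← AdicCompletion.Ideal.mk_eq_mk m hin f, ← (hdvd i a).mpr h]
    exact Ideal.Quotient.eq.mpr (Ideal.pow_le_pow_right hin (Ideal.Quotient.eq.mp ha.symm))
  have : Nontrivial (AdicCompletion m R) := by
    refine ⟨0, 1, fun h => ?_⟩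
    have h1 := congrArg (AdicCompletion.evalₐ m 1) h
    rw [map_zero, map_one, eq_comm, ← map_one (Ideal.Quotient.mk (m ^ 1)),
      Ideal.Quotient.eq_zero_iff_mem, pow_one] at h1
    exact hm.ne_top ((Ideal.eq_top_iff_one m).mpr h1)
  have : NoZeroDivisors (AdicCompletion m R) := by
    refine ⟨fun {x y} hxy => ?_⟩
    by_contra hcon
    rw [not_or] at hcon
    obtain ⟨i, hi⟩ : ∃ i, AdicCompletion.evalₐ m i x ≠ 0 := by
      by_contra! hall
      exact hcon.1 (AdicCompletion.ext_evalₐ fun n => by rw [hall n, map_zero])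
    obtain ⟨j, hj⟩ : ∃ j, AdicCompletion.evalₐ m j y ≠ 0 := by
      by_contra! hall
      exact hcon.2 (AdicCompletion.ext_evalₐ fun n => by rw [hall n, map_zero])
    obtain ⟨a, ha⟩ := Ideal.Quotient.mk_surjective (AdicCompletion.evalₐ m (i + j) x)
    obtain ⟨b, hb⟩ := Ideal.Quotient.mk_surjective (AdicCompletion.evalₐ m (i + j) y)
    have hab : p ^ (i + j) ∣ a * b := by
      rw [← hdvd, map_mul, ha, hb, ← map_mul, hxy, map_zero]
    rcases key i j a b hab with h | h
    · exact hi (hlow i (i + j) (Nat.le_add_right i j) a x ha h)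
    · exact hj (hlow j (i + j) (Nat.le_add_left j i) b y hb h)
  exact NoZeroDivisors.to_isDomain _

/-- The absolute integral closure `D⁺` of an integral domain `D`: the integral closure of `D` in
an algebraic closure of its fraction field. -/
abbrev AbsoluteIntegralClosure (D : Type*) [CommRing D] [IsDomain D] : Type _ :=
  integralClosure D (AlgebraicClosure (FractionRing D))

/-!
Write `R̂` for the completion of `R` at a maximal ideal `m = (p)`.

Up to units, every nonzero element of `R̂` is a power of `p`
(`AdicCompletion.exists_eq_unit_mul_pow`), so `R̂` is an integrally closed complete local domain.
Over such a ring `D`, Weierstrass preparation shows that the minimal polynomial of a nonunit of an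
integral extension `B` is distinguished (`minpoly_isDistinguishedAt`). Hence the nonunits of `B`
form the radical of the extended maximal ideal and `B` is local; with `B = D⁺` this is the first
claim.

For a nonzero `α` in the maximal ideal of `R̂⁺`, with minimal polynomial `g`, Weierstrass division
gives `R̂⟦X⟧ / (g) ≃ R̂[X] / (g)`, which maps onto `R̂[α]`. Since `g(0)` is a unit times a power of
`p`, `R` is dense in `R̂` modulo `g(0)`, and successive approximation shows that already `R⟦X⟧` maps
onto `R̂⟦X⟧ / (g)` (`exists_surjective_powerSeries_to_adjoin`).

Conversely, let `P` be a prime ideal of `R⟦X⟧`. If `X ∈ P`, the quotient is a quotient of `R`.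
Otherwise `P = (f)` is principal. If `P ≠ 0`, choose a prime `p` dividing the constant coefficient
of `f` and put `m = (p)`. A prime ideal that contains `P` and not `X` is principal too, hence equal
to `P` (`PowerSeries.eq_of_le_of_X_notMem`). If `f` vanishes modulo `m`, this applies to the kernel
of `R⟦X⟧ → (R/m)⟦X⟧`. If not, Weierstrass preparation over `R̂` gives a zero `α` of `f` in the
maximal ideal of `R̂⁺` (`exists_minpoly_dvd_map`), and it applies to the kernel of the evaluation
`R⟦X⟧ → R̂[α]`.
-/

/-! ### Integral extensions of complete local domains -/

section CompleteLocal

open IsLocalRing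

open PowerSeries in
/-- A distinguished polynomial that divides a polynomial `f` as a power series divides it as a
polynomial: division with remainder in `D[X]` is a Weierstrass division, and so is the
factorization in `D⟦X⟧`, hence the remainder is zero. -/
theorem Polynomial.IsDistinguishedAt.dvd_of_eq_mul {D : Type*} [CommRing D] [IsLocalRing D]
    [IsAdicComplete (maximalIdeal D) D] {w f : Polynomial D} {h : D⟦X⟧}
    (hw : w.IsDistinguishedAt (maximalIdeal D)) (e : (f : D⟦X⟧) = w * h) : w ∣ f := by
  have hw0 : (w : D⟦X⟧).map (residue D) ≠ 0 := by
    rw [← Polynomial.polynomial_map_coe]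
    exact_mod_cast w.map_monic_ne_zero (f := residue D) hw.monic
  have hord : w.natDegree = ((w : D⟦X⟧).map (Ideal.Quotient.mk (maximalIdeal D))).order.toNat :=
    (show (w : D⟦X⟧).IsWeierstrassFactorizationAt w 1 (maximalIdeal D) from
      ⟨hw, isUnit_one, (mul_one _).symm⟩).natDegree_eq_toNat_order_map_of_ne_top
        (Ideal.IsPrime.ne_top inferInstance)
  have H1 : (f : D⟦X⟧).IsWeierstrassDivision w h 0 :=
    ⟨by rw [Polynomial.degree_zero]; exact WithBot.bot_lt_coe _, by simp [e]⟩
  have H2 : (f : D⟦X⟧).IsWeierstrassDivision w (f /ₘ w : Polynomial D) (f %ₘ w) := by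
    refine ⟨?_, ?_⟩
    · rw [← hord, ← Polynomial.degree_eq_natDegree hw.monic.ne_zero]
      exact Polynomial.degree_modByMonic_lt _ hw.monic
    · rw [← Polynomial.coe_mul, ← Polynomial.coe_add, add_comm, Polynomial.modByMonic_add_div]
  have := (H1.elim hw0 H2).2
  rwa [eq_comm, Polynomial.modByMonic_eq_zero_iff_dvd hw.monic] at this

theorem isUnit_of_aeval_eq_zero_of_isUnit_coeff_zero {D B : Type*} [CommRing D] [CommRing B]
    [Algebra D B] {f : Polynomial D} {x : B}
    (hx : Polynomial.aeval x f = 0) (h0 : IsUnit (f.coeff 0)) : IsUnit x := by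
  have h1 := congrArg (Polynomial.aeval x) f.divX_mul_X_add
  rw [hx, map_add, map_mul, Polynomial.aeval_X, Polynomial.aeval_C] at h1
  have h2 : x ∣ algebraMap D B (f.coeff 0) := by
    rw [eq_neg_of_add_eq_zero_right h1, dvd_neg]
    exact dvd_mul_left _ _
  exact isUnit_of_dvd_unit h2 (h0.map _)

/-- A root of a distinguished polynomial of degree `d` has its `d`-th power in the extended maximal
ideal. -/
theorem mem_radical_map_of_isDistinguishedAt {D B : Type*} [CommRing D]
    [IsLocalRing D] [CommRing B] [Algebra D B] {w : Polynomial D} {x : B}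
    (hw : w.IsDistinguishedAt (maximalIdeal D)) (hx : Polynomial.aeval x w = 0) :
    x ∈ ((maximalIdeal D).map (algebraMap D B)).radical :=
  ⟨_, hw.toIsWeaklyEisensteinAt.pow_natDegree_le_of_aeval_zero_of_monic_mem_map hx hw.monic _
    (Polynomial.natDegree_map_le)⟩

theorem radical_map_maximalIdeal_ne_top (D B : Type*) [CommRing D] [IsDomain D]
    [IsLocalRing D] [CommRing B] [IsDomain B] [Algebra D B] [Algebra.IsIntegral D B]
    [Module.IsTorsionFree D B] :
    ((maximalIdeal D).map (algebraMap D B)).radical ≠ ⊤ := by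
  rw [Ne, Ideal.radical_eq_top]
  intro h
  obtain ⟨Q, hQ, hQ'⟩ := Ideal.exists_ideal_over_maximal_of_isIntegral (S := B) (maximalIdeal D)
    (by rw [(RingHom.injective_iff_ker_eq_bot _).1 (FaithfulSMul.algebraMap_injective D B)]
        exact bot_le)
  exact hQ.ne_top (top_le_iff.1 (h ▸ Ideal.map_le_iff_le_comap.2 hQ'.ge))

variable {D : Type*} [CommRing D] [IsDomain D] [IsLocalRing D] [IsIntegrallyClosed D]
  [IsAdicComplete (maximalIdeal D) D] {B : Type*} [CommRing B] [IsDomain B] [Algebra D B]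
  [Algebra.IsIntegral D B] [Module.IsTorsionFree D B]

open PowerSeries in
/-- The minimal polynomial of a nonunit is distinguished: by Weierstrass preparation it is a
distinguished polynomial times a unit power series, and irreducibility leaves no room for
anything but the distinguished factor. -/
theorem minpoly_isDistinguishedAt {x : B} (hx : ¬ IsUnit x) :
    (minpoly D x).IsDistinguishedAt (maximalIdeal D) := by
  have hint : IsIntegral D x := Algebra.IsIntegral.isIntegral x
  set f := minpoly D x with hf
  have hmon : f.Monic := minpoly.monic hint
  have hf0 : (f : D⟦X⟧).map (residue D) ≠ 0 := by
    rw [← Polynomial.polynomial_map_coe]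
    exact_mod_cast f.map_monic_ne_zero (f := residue D) hmon
  obtain ⟨w, h, hw, hu, e⟩ := exists_isWeierstrassFactorization hf0
  obtain ⟨q, hq⟩ := hw.dvd_of_eq_mul e
  have hqm : q.Monic := Polynomial.Monic.of_mul_monic_left hw.monic (hq ▸ hmon)
  have hz : Polynomial.aeval x w * Polynomial.aeval x q = 0 := by
    rw [← map_mul, ← hq, minpoly.aeval]
  rcases mul_eq_zero.1 hz with h1 | h1
  · have : f ∣ w := minpoly.isIntegrallyClosed_dvd hint h1
    rwa [Polynomial.eq_of_monic_of_associated hmon hw.monic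
      (associated_of_dvd_dvd this ⟨q, hq⟩)]
  -- if instead `x` is a root of `q`, then `w = 1`, and `f(0)` is a unit
  · have h2 : f ∣ q := minpoly.isIntegrallyClosed_dvd hint h1
    have h3 : f = q := Polynomial.eq_of_monic_of_associated hmon hqm
      (associated_of_dvd_dvd h2 ⟨w, by rw [hq, mul_comm]⟩)
    have h4 : w = 1 := by
      have : w * q = 1 * q := by rw [← hq, one_mul, h3]
      exact mul_right_cancel₀ hqm.ne_zero this
    rw [h4, Polynomial.coe_one, one_mul] at e
    refine absurd (isUnit_of_aeval_eq_zero_of_isUnit_coeff_zero (minpoly.aeval D x) ?_) hx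
    rw [← hf, ← Polynomial.coeff_coe, e, coeff_zero_eq_constantCoeff_apply]
    exact isUnit_iff_constantCoeff.1 hu

/-- An integral domain extension of a complete integrally closed local domain is local: its
nonunits are the elements of the radical of the extended maximal ideal. -/
theorem isLocalRing_of_isIntegral_of_isAdicComplete (D B : Type*) [CommRing D] [IsDomain D]
    [IsLocalRing D] [IsIntegrallyClosed D] [IsAdicComplete (maximalIdeal D) D] [CommRing B]
    [IsDomain B] [Algebra D B] [Algebra.IsIntegral D B] [Module.IsTorsionFree D B] :
    IsLocalRing B := by
  have key : ∀ x : B, ¬ IsUnit x → x ∈ ((maximalIdeal D).map (algebraMap D B)).radical :=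
    fun x hx => mem_radical_map_of_isDistinguishedAt (minpoly_isDistinguishedAt hx)
      (minpoly.aeval D x)
  exact .of_nonunits_add fun a b ha hb hab => radical_map_maximalIdeal_ne_top D B
    (Ideal.eq_top_of_isUnit_mem _ (add_mem (key a ha) (key b hb)) hab)

end CompleteLocal

/-! ### Successive approximation of power series -/

section Surjectivity

/-- If every element of `D` is congruent to an element of `R` modulo the constant coefficient of
`g`, then every power series over `D` is congruent to one over `R` modulo `g`. -/
theorem PowerSeries.exists_map_add_mul {R D : Type*} [CommRing R] [CommRing D] (ι : R →+* D)
    (g : D⟦X⟧) (h : ∀ d, ∃ r q, d = ι r + PowerSeries.constantCoeff g * q) (f : D⟦X⟧) :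
    ∃ (a : R⟦X⟧) (b : D⟦X⟧), f = PowerSeries.map ι a + g * b := by
  choose r q hrq using h
  -- the tail `T f` of `f` satisfies `f = ι r + q * g + X * T f` with constants `r`, `q`
  let T : D⟦X⟧ → D⟦X⟧ := fun f => PowerSeries.mk fun n =>
    PowerSeries.coeff (n + 1) (f - PowerSeries.C (q (PowerSeries.constantCoeff f)) * g)
  have hT : ∀ f, f = PowerSeries.C (ι (r (PowerSeries.constantCoeff f))) +
      PowerSeries.C (q (PowerSeries.constantCoeff f)) * g + PowerSeries.X * T f := by
    intro f
    have := PowerSeries.eq_X_mul_shift_add_const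
      (f - PowerSeries.C (q (PowerSeries.constantCoeff f)) * g)
    rw [sub_eq_iff_eq_add] at this
    refine this.trans ?_
    have h2 : PowerSeries.constantCoeff (f - PowerSeries.C (q (PowerSeries.constantCoeff f)) * g)
        = ι (r (PowerSeries.constantCoeff f)) := by
      rw [map_sub, map_mul, PowerSeries.constantCoeff_C, sub_eq_iff_eq_add,
        mul_comm (q _)]
      exact hrq _
    rw [h2]
    simp only [T]
    ring
  let a : D⟦X⟧ → R⟦X⟧ := fun f =>
    PowerSeries.mk fun n => r (PowerSeries.constantCoeff (T^[n] f))
  let b : D⟦X⟧ → D⟦X⟧ := fun f =>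
    PowerSeries.mk fun n => q (PowerSeries.constantCoeff (T^[n] f))
  have ha : ∀ f, a f =
      PowerSeries.C (r (PowerSeries.constantCoeff f)) + PowerSeries.X * a (T f) := by
    intro f
    rw [add_comm]
    refine (PowerSeries.eq_X_mul_shift_add_const (a f)).trans ?_
    simp [a]
  have hb : ∀ f, b f =
      PowerSeries.C (q (PowerSeries.constantCoeff f)) + PowerSeries.X * b (T f) := by
    intro f
    rw [add_comm]
    refine (PowerSeries.eq_X_mul_shift_add_const (b f)).trans ?_
    simp [b]
  have he : ∀ f, f - (PowerSeries.map ι (a f) + g * b f) =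
      PowerSeries.X * (T f - (PowerSeries.map ι (a (T f)) + g * b (T f))) := by
    intro f
    nth_rewrite 1 [hT f]
    rw [ha f, hb f, map_add, map_mul, PowerSeries.map_C, PowerSeries.map_X]
    ring
  have hn : ∀ n f, PowerSeries.X ^ n ∣ f - (PowerSeries.map ι (a f) + g * b f) := by
    intro n
    induction n with
    | zero => simp
    | succ n ih =>
      intro f
      rw [he f, pow_succ']
      exact mul_dvd_mul_left _ (ih _)
  refine ⟨a f, b f, ?_⟩
  rw [← sub_eq_zero]
  ext n
  exact PowerSeries.X_pow_dvd_iff.1 (hn (n + 1) f) n (Nat.lt_succ_self n)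

end Surjectivity

/-! ### Completions of principal ideal domains -/

section Completion

open IsLocalRing

variable {R : Type*} [CommRing R]

theorem AdicCompletion.isMaximal_map_algebraMap [IsNoetherianRing R] (m : Ideal R) [m.IsMaximal] :
    (m.map (algebraMap R (AdicCompletion m R))).IsMaximal :=
  AdicCompletion.isMaximal_map_of_le m m le_rfl (IsNoetherian.noetherian m)

theorem AdicCompletion.isLocalRing_of_isMaximal [IsNoetherianRing R] (m : Ideal R) [m.IsMaximal] :
    IsLocalRing (AdicCompletion m R) :=
  have := AdicCompletion.isMaximal_map_algebraMap m
  have := AdicCompletion.isAdicComplete_self m (IsNoetherian.noetherian m)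
  isLocalRing_of_isAdicComplete_maximal (m.map (algebraMap R (AdicCompletion m R)))

theorem AdicCompletion.map_algebraMap_eq_maximalIdeal [IsNoetherianRing R] (m : Ideal R)
    [m.IsMaximal] [IsLocalRing (AdicCompletion m R)] :
    m.map (algebraMap R (AdicCompletion m R)) = maximalIdeal (AdicCompletion m R) :=
  IsLocalRing.eq_maximalIdeal (AdicCompletion.isMaximal_map_algebraMap m)

theorem AdicCompletion.isAdicComplete_maximalIdeal [IsNoetherianRing R] (m : Ideal R)
    [m.IsMaximal] [IsLocalRing (AdicCompletion m R)] :
    IsAdicComplete (maximalIdeal (AdicCompletion m R)) (AdicCompletion m R) :=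
  AdicCompletion.map_algebraMap_eq_maximalIdeal m ▸
    AdicCompletion.isAdicComplete_self m (IsNoetherian.noetherian m)

theorem AdicCompletion.map_algebraMap_eq_span {m : Ideal R} {p : R} (hp : m = Ideal.span {p}) :
    m.map (algebraMap R (AdicCompletion m R)) =
      Ideal.span {algebraMap R (AdicCompletion m R) p} := by
  refine (congrArg (Ideal.map (algebraMap R (AdicCompletion m R))) hp).trans ?_
  rw [Ideal.map_span, Set.image_singleton]

/-- `R` is dense in its completion along `(p)`. -/
theorem AdicCompletion.exists_eq_algebraMap_add_pow_mul {m : Ideal R} {p : R}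
    (hp : m = Ideal.span {p}) (n : ℕ) (d : AdicCompletion m R) :
    ∃ r q, d =
      algebraMap R (AdicCompletion m R) r + algebraMap R (AdicCompletion m R) p ^ n * q := by
  have step : ∀ d : AdicCompletion m R, ∃ r q,
      d = algebraMap R (AdicCompletion m R) r + algebraMap R (AdicCompletion m R) p * q := by
    intro d
    obtain ⟨r, hr⟩ := Ideal.Quotient.mk_surjective (AdicCompletion.evalOneₐ m d)
    have h : d - algebraMap R (AdicCompletion m R) r ∈
        RingHom.ker (AdicCompletion.evalOneₐ m).toRingHom := by
      rw [RingHom.mem_ker, map_sub, sub_eq_zero]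
      refine hr.symm.trans ?_
      exact (RingHom.congr_fun (AdicCompletion.evalOneₐ_comp_algebraMap_eq_mk m) r).symm
    rw [AdicCompletion.ker_evalOneₐ_eq_map m (hp ▸ ⟨{p}, by simp⟩)] at h
    rw [map_algebraMap_eq_span hp, Ideal.mem_span_singleton] at h
    obtain ⟨q, hq⟩ := h
    exact ⟨r, q, by rw [← hq]; ring⟩
  induction n with
  | zero => exact ⟨0, d, by simp⟩
  | succ n ih =>
    obtain ⟨r, q, h⟩ := ih
    obtain ⟨r', q', h'⟩ := step q
    exact ⟨r + p ^ n * r', q', by rw [h, h', map_add, map_mul, map_pow]; ring⟩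

variable [IsDomain R] [IsPrincipalIdealRing R]

/-- The completion at `(p)` is a discrete valuation ring with uniformizer `p`, or a field. -/
theorem AdicCompletion.exists_eq_unit_mul_pow {m : Ideal R} [m.IsMaximal] {p : R}
    (hp : m = Ideal.span {p}) {d : AdicCompletion m R} (hd : d ≠ 0) :
    ∃ (u : (AdicCompletion m R)ˣ) (n : ℕ), d = u * algebraMap R (AdicCompletion m R) p ^ n := by
  have := AdicCompletion.isLocalRing_of_isMaximal m
  have hc := AdicCompletion.isAdicComplete_maximalIdeal m
  have hmax : maximalIdeal (AdicCompletion m R) =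
      Ideal.span {algebraMap R (AdicCompletion m R) p} := by
    rw [← AdicCompletion.map_algebraMap_eq_maximalIdeal m, map_algebraMap_eq_span hp]
  have hfin : FiniteMultiplicity (algebraMap R (AdicCompletion m R) p) d := by
    by_contra h
    refine hd (hc.haus _ fun n => ?_)
    rw [SModEq.zero, smul_eq_mul, Ideal.mul_top, hmax, Ideal.span_singleton_pow,
      Ideal.mem_span_singleton]
    exact FiniteMultiplicity.not_iff_forall.1 h n
  obtain ⟨c, hc1, hc2⟩ := hfin.exists_eq_pow_mul_and_not_dvd
  have hu : IsUnit c := by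
    by_contra h
    rw [← mem_nonunits_iff, ← mem_maximalIdeal, hmax, Ideal.mem_span_singleton] at h
    exact hc2 h
  exact ⟨hu.unit, _, by rw [mul_comm]; exact hc1⟩

theorem AdicCompletion.isIntegrallyClosed_of_isMaximal (m : Ideal R) [m.IsMaximal] :
    IsIntegrallyClosed (AdicCompletion m R) := by
  obtain ⟨p, hp⟩ : ∃ p, m = Ideal.span {p} := ⟨_, (Ideal.span_singleton_generator m).symm⟩
  have : ValuationRing (AdicCompletion m R) := by
    refine ValuationRing.iff_dvd_total.2 ⟨fun a b => ?_⟩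
    rcases eq_or_ne a 0 with rfl | ha
    · exact Or.inr (dvd_zero b)
    rcases eq_or_ne b 0 with rfl | hb
    · exact Or.inl (dvd_zero a)
    obtain ⟨u, i, rfl⟩ := AdicCompletion.exists_eq_unit_mul_pow hp ha
    obtain ⟨v, j, rfl⟩ := AdicCompletion.exists_eq_unit_mul_pow hp hb
    simp only [Units.dvd_mul_left, Units.mul_left_dvd]
    exact (le_total i j).imp (pow_dvd_pow _) (pow_dvd_pow _)
  infer_instance

theorem AdicCompletion.algebraMap_injective_of_isMaximal (m : Ideal R) [hm : m.IsMaximal] :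
    Function.Injective (algebraMap R (AdicCompletion m R)) := by
  have := IsHausdorff.of_isDomain (I := m) hm.ne_top
  exact AdicCompletion.of_injective m R

instance faithfulSMul_algebraicClosure_fractionRing (D : Type*) [CommRing D] [IsDomain D] :
    FaithfulSMul D (AlgebraicClosure (FractionRing D)) :=
  FaithfulSMul.trans D (FractionRing D) (AlgebraicClosure (FractionRing D))

instance isTorsionFree_absoluteIntegralClosure (D : Type*) [CommRing D] [IsDomain D] :
    Module.IsTorsionFree D (AbsoluteIntegralClosure D) := by
  have : FaithfulSMul D (AbsoluteIntegralClosure D) := inferInstance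
  infer_instance

instance AdicCompletion.isLocalRing_absoluteIntegralClosure (m : Ideal R) [m.IsMaximal] :
    IsLocalRing (AbsoluteIntegralClosure (AdicCompletion m R)) :=
  have := AdicCompletion.isLocalRing_of_isMaximal m
  have := AdicCompletion.isAdicComplete_maximalIdeal m
  have := AdicCompletion.isIntegrallyClosed_of_isMaximal m
  isLocalRing_of_isIntegral_of_isAdicComplete (AdicCompletion m R) _

theorem eq_zero_of_minpoly_eq_X_mul {D B : Type*} [CommRing D] [IsDomain D] [CommRing B]
    [IsDomain B] [Algebra D B] {x : B} (hx : IsIntegral D x) {q : Polynomial D}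
    (h : minpoly D x = Polynomial.X * q) : x = 0 := by
  have hz := minpoly.aeval D x
  rw [h, map_mul, Polynomial.aeval_X] at hz
  refine (mul_eq_zero.1 hz).resolve_right fun hq => ?_
  have hmon := minpoly.monic hx
  rw [h] at hmon
  have hqm : q.Monic := Polynomial.Monic.of_mul_monic_left Polynomial.monic_X hmon
  have hle := Polynomial.natDegree_le_natDegree (minpoly.min D x hqm hq)
  rw [h, Polynomial.natDegree_X_mul hqm.ne_zero] at hle
  omega

open PowerSeries in
/-- Evaluation of power series over `R` at a nonzero nonunit `α` of an integral
extension of `R̂_m`. It is surjective onto `R̂_m[α]` because the constant coefficient of the minimal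
polynomial of `α` is, up to a unit, a power of the generator of `m`, so that `R` is dense modulo
this coefficient. -/
theorem exists_surjective_powerSeries_to_adjoin (m : Ideal R) [m.IsMaximal]
    {B : Type*} [CommRing B] [IsDomain B] [Algebra (AdicCompletion m R) B]
    [Algebra.IsIntegral (AdicCompletion m R) B] [Module.IsTorsionFree (AdicCompletion m R) B]
    {α : B} (hα : ¬ IsUnit α) (h0 : α ≠ 0) :
    ∃ φ : R⟦X⟧ →+* Algebra.adjoin (AdicCompletion m R) {α}, Function.Surjective φ ∧
      (φ X : B) = α ∧
      ∀ f, ((minpoly (AdicCompletion m R) α : Polynomial (AdicCompletion m R)) :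
        (AdicCompletion m R)⟦X⟧) ∣ f.map (algebraMap R (AdicCompletion m R)) → φ f = 0 := by
  have := AdicCompletion.isLocalRing_of_isMaximal m
  have := AdicCompletion.isAdicComplete_maximalIdeal m
  have := AdicCompletion.isIntegrallyClosed_of_isMaximal m
  obtain ⟨p, hp⟩ : ∃ p, m = Ideal.span {p} := ⟨_, (Ideal.span_singleton_generator m).symm⟩
  have hint : IsIntegral (AdicCompletion m R) α := Algebra.IsIntegral.isIntegral α
  set g := minpoly (AdicCompletion m R) α with hg
  have hdist : g.IsDistinguishedAt (maximalIdeal (AdicCompletion m R)) :=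
    minpoly_isDistinguishedAt hα
  have hg0 : constantCoeff (g : (AdicCompletion m R)⟦X⟧) ≠ 0 := by
    rw [← coeff_zero_eq_constantCoeff_apply, Polynomial.coeff_coe]
    intro h
    obtain ⟨q, hq⟩ := Polynomial.X_dvd_iff.2 h
    exact h0 (eq_zero_of_minpoly_eq_X_mul hint hq)
  obtain ⟨u, n, hun⟩ := AdicCompletion.exists_eq_unit_mul_pow hp hg0
  have hdense : ∀ d, ∃ r q, d = algebraMap R (AdicCompletion m R) r +
      constantCoeff (g : (AdicCompletion m R)⟦X⟧) * q := by
    intro d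
    obtain ⟨r, q, h⟩ := AdicCompletion.exists_eq_algebraMap_add_pow_mul hp n d
    refine ⟨r, ↑u⁻¹ * q, h.trans ?_⟩
    rw [hun]
    linear_combination (-(algebraMap R (AdicCompletion m R) p ^ n * q)) * u.mul_inv
  have hmem : α ∈ Algebra.adjoin (AdicCompletion m R) {α} := Algebra.self_mem_adjoin_singleton _ α
  let a : Algebra.adjoin (AdicCompletion m R) {α} := ⟨α, hmem⟩
  have ha : ∀ f : Polynomial (AdicCompletion m R),
      (Polynomial.aeval a f : B) =
        Polynomial.aeval α f := fun f => Polynomial.aeval_subalgebra_coe f _ a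
  let ψ : (Polynomial (AdicCompletion m R) ⧸ Ideal.span {g}) →ₐ[AdicCompletion m R]
      Algebra.adjoin (AdicCompletion m R) {α} :=
    Ideal.Quotient.liftₐ _ (Polynomial.aeval a) (by
      intro f hf
      obtain ⟨q, rfl⟩ := Ideal.mem_span_singleton.1 hf
      rw [map_mul]
      have : Polynomial.aeval a g = 0 := Subtype.ext ((ha g).trans (minpoly.aeval _ α))
      rw [this, zero_mul])
  have hψ : Function.Surjective ψ := by
    rintro ⟨x, hx⟩
    obtain ⟨f, hf⟩ := Algebra.adjoin_mem_exists_aeval _ _ hx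
    exact ⟨Ideal.Quotient.mk _ f, Subtype.ext ((ha f).trans hf)⟩
  let e := hdist.algEquivQuotient
  let φ : R⟦X⟧ →+* Algebra.adjoin (AdicCompletion m R) {α} :=
    ((ψ.comp e.symm.toAlgHom).toRingHom.comp
      (Ideal.Quotient.mk (Ideal.span {(g : (AdicCompletion m R)⟦X⟧)}))).comp
        (PowerSeries.map (algebraMap R (AdicCompletion m R)))
  refine ⟨φ, ?_, ?_, ?_⟩
  · intro y
    obtain ⟨z, rfl⟩ := (hψ.comp e.symm.surjective) y
    obtain ⟨f, rfl⟩ := Ideal.Quotient.mk_surjective z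
    obtain ⟨c, b, rfl⟩ := exists_map_add_mul (algebraMap R (AdicCompletion m R)) _ hdense f
    refine ⟨c, ?_⟩
    have : Ideal.Quotient.mk (Ideal.span {(g : (AdicCompletion m R)⟦X⟧)})
        (PowerSeries.map (algebraMap R (AdicCompletion m R)) c + g * b) =
        Ideal.Quotient.mk _ (PowerSeries.map (algebraMap R (AdicCompletion m R)) c) := by
      rw [Ideal.Quotient.mk_eq_mk_iff_sub_mem, add_sub_cancel_left]
      exact Ideal.mem_span_singleton.2 (dvd_mul_right _ _)
    simp only [Function.comp_apply, this]
    rfl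
  · have : e.symm (Ideal.Quotient.mk _ (X : (AdicCompletion m R)⟦X⟧)) =
        Ideal.Quotient.mk _ Polynomial.X := by
      rw [AlgEquiv.symm_apply_eq, ← Polynomial.coe_X]
      rfl
    have h2 : φ X = ψ (e.symm (Ideal.Quotient.mk _ (PowerSeries.map
      (algebraMap R (AdicCompletion m R)) X))) := rfl
    rw [h2, PowerSeries.map_X, this]
    exact (ha _).trans (Polynomial.aeval_X α)
  · intro f hf
    have h2 : φ f = ψ (e.symm (Ideal.Quotient.mk _ (PowerSeries.map
      (algebraMap R (AdicCompletion m R)) f))) := rfl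
    rw [h2, Ideal.Quotient.eq_zero_iff_mem.2 (Ideal.mem_span_singleton.2 hf), map_zero, map_zero]

end Completion

/-! ### Prime ideals of power series rings -/

section Primes

open PowerSeries IsLocalRing

variable {R : Type*} [CommRing R]

theorem PowerSeries.exists_eq_span_singleton_of_X_notMem [IsPrincipalIdealRing R]
    {P : Ideal R⟦X⟧} [P.IsPrime] (hX : X ∉ P) : ∃ f, P = Ideal.span {f} := by
  obtain ⟨c, hc⟩ := (IsPrincipalIdealRing.principal (P.map constantCoeff)).principal
  obtain ⟨T, hT, -, hT'⟩ := exist_eq_span_eq_ncard_of_X_notMem hX (S := {c}) hc.symm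
    (Set.finite_singleton c)
  rw [Set.ncard_singleton, Set.ncard_eq_one] at hT'
  obtain ⟨f, rfl⟩ := hT'
  exact ⟨f, hT⟩

variable [IsDomain R] [IsPrincipalIdealRing R]

/-- A prime ideal of `R⟦X⟧` that contains a nonzero prime ideal and not `X` equals it: both are
principal. -/
theorem PowerSeries.eq_of_le_of_X_notMem {P Q : Ideal R⟦X⟧} [hP : P.IsPrime] [hQ : Q.IsPrime]
    (h0 : P ≠ ⊥) (hPQ : P ≤ Q) (hX : X ∉ Q) : P = Q := by
  obtain ⟨f, rfl⟩ := exists_eq_span_singleton_of_X_notMem (fun h => hX (hPQ h))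
  obtain ⟨g, rfl⟩ := exists_eq_span_singleton_of_X_notMem hX
  have hf0 : f ≠ 0 := fun h => h0 (by simp [h])
  have hg0 : g ≠ 0 := by
    rintro rfl
    rw [Ideal.span_singleton_le_span_singleton, zero_dvd_iff] at hPQ
    exact hf0 hPQ
  have hf := (Ideal.span_singleton_prime hf0).1 hP
  have hg := (Ideal.span_singleton_prime hg0).1 hQ
  rw [Ideal.span_singleton_le_span_singleton] at hPQ
  exact Ideal.span_singleton_eq_span_singleton.2
    (hg.irreducible.associated_of_dvd hf.irreducible hPQ).symm

/-- A power series over `R` that does not vanish modulo `m`, and whose constant coefficient is a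
nonzero element of `m`, has a zero in `(R̂_m)⁺`: by Weierstrass preparation over `R̂_m` it is a
unit times a distinguished polynomial, any root of which will do. -/
theorem exists_minpoly_dvd_map (m : Ideal R) [m.IsMaximal] {f : R⟦X⟧}
    (hf : f.map (Ideal.Quotient.mk m) ≠ 0) (hfm : constantCoeff f ∈ m)
    (hf0 : constantCoeff f ≠ 0) :
    ∃ α : AbsoluteIntegralClosure (AdicCompletion m R), ¬ IsUnit α ∧ α ≠ 0 ∧
      ((minpoly (AdicCompletion m R) α : Polynomial (AdicCompletion m R)) :
        (AdicCompletion m R)⟦X⟧) ∣ f.map (algebraMap R (AdicCompletion m R)) := by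
  have := AdicCompletion.isLocalRing_of_isMaximal m
  have := AdicCompletion.isAdicComplete_maximalIdeal m
  have := AdicCompletion.isIntegrallyClosed_of_isMaximal m
  have hcomap : ∀ r, algebraMap R (AdicCompletion m R) r ∈ maximalIdeal (AdicCompletion m R) ↔
      r ∈ m := by
    have : (maximalIdeal (AdicCompletion m R)).comap (algebraMap R (AdicCompletion m R)) = m := by
      refine (Ideal.IsMaximal.eq_of_le ‹_› (Ideal.IsPrime.ne_top inferInstance) ?_).symm
      rw [← Ideal.map_le_iff_le_comap, AdicCompletion.map_algebraMap_eq_maximalIdeal]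
    exact fun r => by rw [← Ideal.mem_comap, this]
  have hres : (f.map (algebraMap R (AdicCompletion m R))).map
      (residue (AdicCompletion m R)) ≠ 0 := by
    contrapose! hf
    ext n
    have := congrArg (coeff n) hf
    rw [coeff_map, coeff_map, map_zero, residue_eq_zero_iff, hcomap] at this
    rw [coeff_map, map_zero, Ideal.Quotient.eq_zero_iff_mem]
    exact this
  obtain ⟨w, h, hw, hu, e⟩ := exists_isWeierstrassFactorization hres
  have e0 := congrArg constantCoeff e
  rw [← coeff_zero_eq_constantCoeff_apply (PowerSeries.map _ f), coeff_map,
    coeff_zero_eq_constantCoeff_apply, map_mul,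
    ← coeff_zero_eq_constantCoeff_apply (w : (AdicCompletion m R)⟦X⟧),
    Polynomial.coeff_coe] at e0
  have hw1 : w.degree ≠ 0 := by
    intro hd
    have : w = 1 := Polynomial.eq_one_of_monic_natDegree_zero hw.monic
      (Polynomial.natDegree_eq_of_degree_eq_some hd)
    rw [this, Polynomial.coeff_one_zero, one_mul] at e0
    exact (mem_maximalIdeal _).1 ((hcomap _).2 hfm) (e0 ▸ isUnit_iff_constantCoeff.1 hu)
  obtain ⟨a, ha⟩ := IsAlgClosed.exists_aeval_eq_zero
    (AlgebraicClosure (FractionRing (AdicCompletion m R))) w hw1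
  let α : AbsoluteIntegralClosure (AdicCompletion m R) := ⟨a, w, hw.monic, ha⟩
  have hα : Polynomial.aeval α w = 0 :=
    Subtype.ext ((Polynomial.aeval_subalgebra_coe w _ α).trans ha)
  refine ⟨α, ?_, ?_, ?_⟩
  · intro hαu
    exact radical_map_maximalIdeal_ne_top (AdicCompletion m R)
      (AbsoluteIntegralClosure (AdicCompletion m R))
      (Ideal.eq_top_of_isUnit_mem _ (mem_radical_map_of_isDistinguishedAt hw hα) hαu)
  · intro h0
    rw [h0, ← Polynomial.coeff_zero_eq_aeval_zero', map_eq_zero_iff _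
      (FaithfulSMul.algebraMap_injective _ _)] at hα
    rw [hα, zero_mul, map_eq_zero_iff _ (AdicCompletion.algebraMap_injective_of_isMaximal m)] at e0
    exact hf0 e0
  · obtain ⟨q, hq⟩ := minpoly.isIntegrallyClosed_dvd (Algebra.IsIntegral.isIntegral α) hα
    exact ⟨q * h, by rw [e, hq, Polynomial.coe_mul, mul_assoc]⟩

/-- The nonzero prime ideals of `R⟦X⟧` that do not contain `X`: the quotient is either
`(R/m)⟦X⟧` or `R̂_m[α]`. -/
theorem PowerSeries.quotient_of_isPrime_of_X_notMem {P : Ideal R⟦X⟧} [hP : P.IsPrime]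
    (hX : X ∉ P) (h0 : P ≠ ⊥) :
    ∃ (m : Ideal R) (_ : m.IsMaximal), Nonempty (R⟦X⟧ ⧸ P ≃+* (R ⧸ m)⟦X⟧) ∨
      ∃ α : AbsoluteIntegralClosure (AdicCompletion m R), ¬ IsUnit α ∧
        Nonempty (R⟦X⟧ ⧸ P ≃+* Algebra.adjoin (AdicCompletion m R) {α}) := by
  obtain ⟨f, hfP⟩ := exists_eq_span_singleton_of_X_notMem hX
  have hfmem : f ∈ P := hfP ▸ Ideal.mem_span_singleton_self f
  have hf0 : f ≠ 0 := fun h => h0 (by simp [hfP, h])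
  have hf : Prime f := (Ideal.span_singleton_prime hf0).1 (hfP ▸ hP)
  have hc0 : constantCoeff f ≠ 0 := by
    intro h
    have := X_prime.irreducible.associated_of_dvd hf.irreducible (X_dvd_iff.2 h)
    exact hX (hfP ▸ Ideal.mem_span_singleton.2 this.symm.dvd)
  obtain ⟨p, hp, hpf⟩ := WfDvdMonoid.exists_irreducible_factor
    (fun h => hf.not_isUnit (isUnit_iff_constantCoeff.2 h)) hc0
  have hm : (Ideal.span {p}).IsMaximal :=
    PrincipalIdealRing.isMaximal_of_irreducible hp
  let := Ideal.Quotient.field (Ideal.span {p})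
  refine ⟨Ideal.span {p}, hm, ?_⟩
  by_cases hmap : f.map (Ideal.Quotient.mk (Ideal.span {p})) = 0
  · left
    have hker : P = RingHom.ker (PowerSeries.map (Ideal.Quotient.mk (Ideal.span {p}))) := by
      have : (RingHom.ker (PowerSeries.map (Ideal.Quotient.mk (Ideal.span {p})))).IsPrime :=
        RingHom.ker_isPrime _
      refine eq_of_le_of_X_notMem h0 ?_ ?_
      · rw [hfP, Ideal.span_singleton_le_iff_mem]
        exact hmap
      · rw [RingHom.mem_ker, map_X]
        exact X_ne_zero
    exact ⟨(Ideal.quotEquivOfEq hker).trans (RingHom.quotientKerEquivOfSurjective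
      (PowerSeries.map_surjective _ Ideal.Quotient.mk_surjective))⟩
  · right
    obtain ⟨α, hα, hα0, hdvd⟩ := exists_minpoly_dvd_map (Ideal.span {p}) hmap
      (Ideal.mem_span_singleton.2 hpf) hc0
    obtain ⟨φ, hφ, hφX, hφ0⟩ :=
      exists_surjective_powerSeries_to_adjoin (Ideal.span {p}) hα hα0
    have hker : P = RingHom.ker φ := by
      have : (RingHom.ker φ).IsPrime := RingHom.ker_isPrime _
      refine eq_of_le_of_X_notMem h0 ?_ ?_
      · rw [hfP, Ideal.span_singleton_le_iff_mem]
        exact hφ0 f hdvd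
      · rw [RingHom.mem_ker]
        intro h
        rw [h] at hφX
        exact hα0 hφX.symm
    exact ⟨α, hα, ⟨(Ideal.quotEquivOfEq hker).trans (RingHom.quotientKerEquivOfSurjective hφ)⟩⟩

/-- A prime ideal of `R⟦X⟧` that contains `X` is the preimage of a prime ideal of `R`. -/
theorem PowerSeries.nonempty_quotient_ringEquiv_of_X_mem {R : Type*} [CommRing R]
    {P : Ideal R⟦X⟧} [hP : P.IsPrime] (hX : X ∈ P) :
    ∃ Q : Ideal R, Q.IsPrime ∧ Nonempty (R⟦X⟧ ⧸ P ≃+* R ⧸ Q) := by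
  have hle : RingHom.ker (constantCoeff (R := R)) ≤ P := by
    intro f hf
    obtain ⟨g, rfl⟩ := X_dvd_iff.2 ((RingHom.mem_ker).1 hf)
    exact P.mul_mem_right _ hX
  have hprime := Ideal.map_isPrime_of_surjective constantCoeff_surj hle
  have hker : P = RingHom.ker ((Ideal.Quotient.mk (P.map (constantCoeff (R := R)))).comp
      constantCoeff) := by
    rw [← RingHom.comap_ker, Ideal.mk_ker, Ideal.comap_map_of_surjective' _ constantCoeff_surj,
      sup_eq_left.2 hle]
  exact ⟨P.map constantCoeff, hprime, ⟨(Ideal.quotEquivOfEq hker).trans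
    (RingHom.quotientKerEquivOfSurjective
      (Ideal.Quotient.mk_surjective.comp constantCoeff_surj))⟩⟩

/-- `R̂_m[α]` is a quotient of `R⟦X⟧` also for `α = 0`: if `m = (p)`, then `R̂_m = R̂_m[p]`, and
if `p = 0`, then `R̂_m = R`. -/
theorem exists_surjective_powerSeries_to_adjoin_of_not_isUnit (m : Ideal R) [hm : m.IsMaximal]
    {B : Type*} [CommRing B] [IsDomain B] [Algebra (AdicCompletion m R) B]
    [Algebra.IsIntegral (AdicCompletion m R) B] [Module.IsTorsionFree (AdicCompletion m R) B]
    {α : B} (hα : ¬ IsUnit α) :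
    ∃ φ : R⟦X⟧ →+* Algebra.adjoin (AdicCompletion m R) {α}, Function.Surjective φ := by
  rcases eq_or_ne α 0 with rfl | h0
  swap
  · obtain ⟨φ, hφ, -⟩ := exists_surjective_powerSeries_to_adjoin m hα h0
    exact ⟨φ, hφ⟩
  obtain ⟨p, hp⟩ : ∃ p, m = Ideal.span {p} := ⟨_, (Ideal.span_singleton_generator m).symm⟩
  have hinj := AdicCompletion.algebraMap_injective_of_isMaximal m
  have hbot : ∀ d : AdicCompletion m R, Algebra.adjoin (AdicCompletion m R) {algebraMap _ B d} =
      Algebra.adjoin (AdicCompletion m R) {0} := by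
    intro d
    rw [Algebra.adjoin_singleton_algebraMap, Algebra.adjoin_singleton_zero]
  rcases eq_or_ne p 0 with rfl | hp0
  · refine ⟨((algebraMap (AdicCompletion m R) (Algebra.adjoin (AdicCompletion m R) {(0 : B)})).comp
      (algebraMap R (AdicCompletion m R))).comp constantCoeff, ?_⟩
    have h1 : Function.Surjective (algebraMap (AdicCompletion m R)
        (Algebra.adjoin (AdicCompletion m R) {(0 : B)})) := by
      rintro ⟨x, hx⟩
      obtain ⟨d, hd⟩ := Algebra.mem_bot.1
        (Algebra.adjoin_singleton_zero (AdicCompletion m R) B ▸ hx)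
      exact ⟨d, Subtype.ext hd⟩
    have h2 : Function.Surjective (algebraMap R (AdicCompletion m R)) := by
      intro d
      obtain ⟨r, q, h⟩ := AdicCompletion.exists_eq_algebraMap_add_pow_mul hp 1 d
      exact ⟨r, by rw [h, map_zero, pow_one, zero_mul, add_zero]⟩
    exact (h1.comp h2).comp constantCoeff_surj
  · rw [← hbot (algebraMap R (AdicCompletion m R) p)]
    have hp1 : ¬ IsUnit
        (algebraMap (AdicCompletion m R) B (algebraMap R (AdicCompletion m R) p)) := by
      have := AdicCompletion.isLocalRing_of_isMaximal m
      intro hu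
      refine radical_map_maximalIdeal_ne_top (AdicCompletion m R) B
        (Ideal.eq_top_of_isUnit_mem _ (Ideal.le_radical (Ideal.mem_map_of_mem _ ?_)) hu)
      rw [← AdicCompletion.map_algebraMap_eq_maximalIdeal m]
      exact Ideal.mem_map_of_mem _ (hp ▸ Ideal.mem_span_singleton_self p)
    have hp2 : algebraMap (AdicCompletion m R) B (algebraMap R (AdicCompletion m R) p) ≠ 0 := by
      rw [Ne, map_eq_zero_iff _ (FaithfulSMul.algebraMap_injective _ _), map_eq_zero_iff _ hinj]
      exact hp0
    obtain ⟨φ, hφ, -⟩ := exists_surjective_powerSeries_to_adjoin m hp1 hp2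
    exact ⟨φ, hφ⟩

end Primes

/-! ### The classification -/

theorem theorem1p2 {R : Type*} [CommRing R] [IsDomain R] [IsPrincipalIdealRing R] :
    ∃ hloc : ∀ (m : Ideal R) [m.IsMaximal],
        IsLocalRing (AbsoluteIntegralClosure (AdicCompletion m R)),
      ∀ (S : Type*) [CommRing S],
        (IsDomain S ∧ ∃ I : Ideal R⟦X⟧, Nonempty (S ≃+* R⟦X⟧ ⧸ I)) ↔
          (Nonempty (S ≃+* R⟦X⟧) ∨
            Nonempty (S ≃+* R) ∨
            (∃ m : Ideal R, m.IsMaximal ∧ Nonempty (S ≃+* (R ⧸ m)⟦X⟧)) ∨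
            (∃ m : Ideal R, m.IsMaximal ∧ Nonempty (S ≃+* R ⧸ m)) ∨
            ∃ (m : Ideal R) (_ : m.IsMaximal)
              (α : AbsoluteIntegralClosure (AdicCompletion m R)),
              haveI := hloc m
              α ∈ IsLocalRing.maximalIdeal (AbsoluteIntegralClosure (AdicCompletion m R)) ∧
                Nonempty (S ≃+* Algebra.adjoin (AdicCompletion m R) {α})) := by
  refine ⟨fun m _ => inferInstance, fun S _ => ⟨?_, ?_⟩⟩
  · rintro ⟨hS, P, ⟨e⟩⟩
    have hPd : IsDomain (R⟦X⟧ ⧸ P) := e.symm.toMulEquiv.isDomain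
    have hP : P.IsPrime := (Ideal.Quotient.isDomain_iff_prime P).1 hPd
    by_cases hX : PowerSeries.X ∈ P
    · obtain ⟨Q, hQ, ⟨e'⟩⟩ := PowerSeries.nonempty_quotient_ringEquiv_of_X_mem hX
      by_cases hQ0 : Q = ⊥
      · subst hQ0
        exact Or.inr (Or.inl ⟨(e.trans e').trans (RingEquiv.quotientBot R)⟩)
      · exact Or.inr (Or.inr (Or.inr (Or.inl ⟨Q, IsPrime.to_maximal_ideal hQ0, ⟨e.trans e'⟩⟩)))
    · by_cases h0 : P = ⊥
      · subst h0
        exact Or.inl ⟨e.trans (RingEquiv.quotientBot _)⟩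
      · obtain ⟨m, hm, ⟨⟨e'⟩⟩ | ⟨α, hα, ⟨e'⟩⟩⟩ :=
          PowerSeries.quotient_of_isPrime_of_X_notMem hX h0
        · exact Or.inr (Or.inr (Or.inl ⟨m, hm, ⟨e.trans e'⟩⟩))
        · exact Or.inr (Or.inr (Or.inr (Or.inr ⟨m, hm, α,
            (IsLocalRing.mem_maximalIdeal α).2 hα, ⟨e.trans e'⟩⟩)))
  · -- a domain onto which `R⟦X⟧` surjects is a quotient of `R⟦X⟧`
    have of_surj : ∀ {T : Type _} [CommRing T] [IsDomain T], (S ≃+* T) →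
        ∀ φ : R⟦X⟧ →+* T, Function.Surjective φ →
        IsDomain S ∧ ∃ I : Ideal R⟦X⟧, Nonempty (S ≃+* R⟦X⟧ ⧸ I) := fun e φ hφ =>
      ⟨e.toMulEquiv.isDomain, _, ⟨e.trans (RingHom.quotientKerEquivOfSurjective hφ).symm⟩⟩
    rintro (⟨⟨e⟩⟩ | ⟨⟨e⟩⟩ | ⟨m, hm, ⟨e⟩⟩ | ⟨m, hm, ⟨e⟩⟩ | ⟨m, hm, α, hα, ⟨e⟩⟩)
    · exact of_surj e (RingHom.id _) Function.surjective_id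
    · exact of_surj e PowerSeries.constantCoeff PowerSeries.constantCoeff_surj
    · exact of_surj e (PowerSeries.map (Ideal.Quotient.mk m))
        (PowerSeries.map_surjective _ Ideal.Quotient.mk_surjective)
    · exact of_surj e ((Ideal.Quotient.mk m).comp PowerSeries.constantCoeff)
        (Ideal.Quotient.mk_surjective.comp PowerSeries.constantCoeff_surj)
    · obtain ⟨φ, hφ⟩ := exists_surjective_powerSeries_to_adjoin_of_not_isUnit m
        ((IsLocalRing.mem_maximalIdeal α).1 hα)
      exact of_surj e φ hφ
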